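/- Let $G$ be a hyperbolic group, let $A$ be a finite alphabet and let $\pi:A^*\to G$ be a surjective monoid homomorphism such that $A\pi$ is closed under inverses. Write $d_A$ for the word metric of the Cayley graph $\Gamma_A(G)$, $u^{[n]}$ for the prefix of length $n$ of a word $u$ (with $u^{[n]}=u$ if $n>|u|$), $Geo_A(G)=\{w\in A^* : |w|=d_A(1,w\pi)\}$ for the set of geodesic words, and $(g|h)=\frac12(d_A(1,g)+d_A(1,h)-d_A(g,h))$. Words $u,v\in A^*$ are *$p$-MFT* (meeting $p$-fellow travellers) if $u\pi=v\pi$ and $d_A(u^{[n]}\pi,v^{[n]}\pi)\le p$ for all $n\in\mathbb N$. A word $w$ is a $(1,p)$-*quasi-geodesic* if $\big|\,d_A(w^{[i]}\pi,w^{[j]}\pi)-|i-j|\,\big|\le p$ for all $0\le i,j\le |w|$. Geodesics $[x,y]$ are edge paths in $\Gamma_A(G)$ between elements of $G$, regarded as sets of vertices when images, neighbourhoods and Hausdorff distances are taken. A *coarse median* is a map $\mu:G^3\to G$ for which there is a constant $c$ such that $\mu(x,y,z)$ is at distance at most $c$ from every geodesic joining two of $x,y,z$. Let $\varphi\in\mathrm{End}(G)$.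 Then the following are equivalent (that is, the FT-BRP holds for $(\varphi,Geo_A(G),Geo_A(G))$ if and only if the hyperbolic BRP, in any of the formulations (i)–(vii), holds for $\varphi$): - (FT-BRP for $(\varphi,Geo_A(G),Geo_A(G))$) for every $p\ge 0$ there is $q\ge 0$ such that, for all $u_1,u_2,u_3,u_1',u_2',u_3'\in Geo_A(G)$ with $u_i'\pi=u_i\pi\varphi$ for $i=1,2,3$, if $u_1u_2$ and $u_3$ are $p$-MFT, then $u_1'u_2'$ and $u_3'$ are $q$-MFT; - (i) for every $p\ge 0$ there is $q\ge 0$ such that, whenever $u,v\in Geo_A(G)$ and $uv$ is a $(1,p)$-quasi-geodesic, then for all $\alpha,\beta\in Geo_A(G)$ with $\alpha\pi=u\pi\varphi$ and $\beta\pi=v\pi\varphi$, the concatenation $\alpha\beta$ is a $(1,q)$-quasi-geodesic; - (ii) there is $q\ge 0$ such that, whenever $u,v,uv\in Geo_A(G)$, then for all $\alpha,\beta\in Geo_A(G)$ with $\alpha\pi=u\pi\varphi$ and $\beta\pi=v\pi\varphi$, the concatenation $\alpha\beta$ is a $(1,q)$-quasi-geodesic; - (iii) for every $p>0$ there is $q>0$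 such that for all $u,v\in G$, $(u|v)\le p$ implies $(u\varphi|v\varphi)\le q$; - (iv) there is $q>0$ such that for all $u,v\in G$, $(u|v)=0$ implies $(u\varphi|v\varphi)\le q$; - (v) there is $N\in\mathbb N$ such that for all $x,y\in G$ and every geodesic $\alpha=[x,y]$, $\alpha\varphi$ is at Hausdorff distance at most $N$ from every geodesic $[x\varphi,y\varphi]$; - (vi) there is $N\in\mathbb N$ such that for all $x,y\in G$ and every geodesic $\alpha=[x,y]$, $\alpha\varphi$ is contained in the $N$-neighbourhood of every geodesic $[x\varphi,y\varphi]$; - (vii) $\varphi$ is coarse-median preserving: there are a coarse median $\mu$ and a constant $C$ with $d_A(\mu(x,y,z)\varphi,\mu(x\varphi,y\varphi,z\varphi))\le C$ for all $x,y,z\in G$. -/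

import Mathlib

namespace BRP

/-- The combinatorial distance in the (undirected) Cayley graph of `G` with respect to `S`: the
length of a shortest edge path. -/
noncomputable def cayleyDist {G : Type*} [Group G] (S : Set G) (x y : G) : ℕ :=
  (SimpleGraph.mulCayley S).dist x y

/-- The Gromov product `(g | h)_p` with respect to the distance `cayleyDist S`. -/
noncomputable def gromovProduct {G : Type*} [Group G] (S : Set G) (p g h : G) : ℝ :=
  ((cayleyDist S p g : ℝ) + (cayleyDist S p h : ℝ) - (cayleyDist S g h : ℝ)) / 2

/-- A group is hyperbolic if it has a finite generating set for which the Cayley graph is Gromov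
hyperbolic (Gromov's four point condition). -/
def IsHyperbolicGroup (G : Type*) [Group G] : Prop :=
  ∃ S : Set G, S.Finite ∧ Subgroup.closure S = ⊤ ∧
    ∃ δ : ℝ, ∀ w x y z : G,
      min (gromovProduct S w x y) (gromovProduct S w y z) - δ ≤ gromovProduct S w x z

section Words

variable {G : Type*} [Group G] {A : Type*} (π : FreeMonoid A →* G)

/-- The element of `G` represented by a word. -/
def val (w : List A) : G := π (FreeMonoid.ofList w)

/-- The set `Aπ` of elements of `G` represented by the letters. -/
def gens : Set G := Set.range fun a : A => π (FreeMonoid.of a)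

/-- The distance `d_A` in the Cayley graph `Γ_A(G)`. -/
noncomputable def dist (x y : G) : ℕ := cayleyDist (gens π) x y

/-- `Geo_A(G)`: the words that label geodesics of `Γ_A(G)`. -/
def Geo : Language A := {w | w.length = dist π 1 (val π w)}

/-- `u` and `v` are `p`-fellow travellers: equally long prefixes are at distance at most `p`
(`w.take n` is `w` when `n` exceeds the length of `w`). -/
def FellowTravel (p : ℝ) (u v : List A) : Prop :=
  ∀ n : ℕ, (dist π (val π (u.take n)) (val π (v.take n)) : ℝ) ≤ p

/-- `u` and `v` are `p`-MFT (meeting fellow travellers): they represent the same element and are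
`p`-fellow travellers. -/
def MFT (p : ℝ) (u v : List A) : Prop :=
  val π u = val π v ∧ FellowTravel π p u v

/-- The set of vertices of the path of `Γ_A(G)` that starts at `x` and is labelled by `w`. -/
def pathSet (x : G) (w : List A) : Set G :=
  Set.range fun n : ℕ => x * val π (w.take n)

/-- The closed `N`-neighbourhood of `Z` with respect to `d_A`. -/
def nbhd (N : ℕ) (Z : Set G) : Set G := {x | ∃ z ∈ Z, dist π x z ≤ N}

/-- The path labelled by `w` is a `(lam, K)`-quasi-geodesic: the map sending `n` to the vertex
reached after `n` letters, `0 ≤ n ≤ |w|`, is a `(lam, K)`-quasi-isometric embedding. -/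
def IsQuasiGeodesic (lam K : ℝ) (w : List A) : Prop :=
  ∀ i j : ℕ, i ≤ w.length → j ≤ w.length →
    (1 / lam) * |(i : ℝ) - (j : ℝ)| - K ≤ (dist π (val π (w.take i)) (val π (w.take j)) : ℝ) ∧
    (dist π (val π (w.take i)) (val π (w.take j)) : ℝ) ≤ lam * |(i : ℝ) - (j : ℝ)| + K

/-- `μ` is a coarse median operator of the hyperbolic Cayley graph: `μ x y z` is at uniformly
bounded distance from every geodesic joining two of the three points `x`, `y`, `z`. -/
def IsCoarseMedian (μ : G → G → G → G) : Prop :=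
  ∃ c : ℕ, ∀ x y z : G, ∀ w ∈ Geo π,
    (x * val π w = y → μ x y z ∈ nbhd π c (pathSet π x w)) ∧
    (y * val π w = z → μ x y z ∈ nbhd π c (pathSet π y w)) ∧
    (z * val π w = x → μ x y z ∈ nbhd π c (pathSet π z w))

end Words

/-- The fellow traveller bounded reduction property for `(φ, L₁, L₂)`. -/
def FTBRP {G₁ G₂ : Type*} [Group G₁] [Group G₂] {A B : Type*}
    (π₁ : FreeMonoid A →* G₁) (π₂ : FreeMonoid B →* G₂) (φ : G₁ →* G₂)
    (L₁ : Language A) (L₂ : Language B) : Prop :=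
  ∀ p : ℝ, 0 ≤ p → ∃ q : ℝ, 0 ≤ q ∧
    ∀ u₁ ∈ L₁, ∀ u₂ ∈ L₁, ∀ u₃ ∈ L₁, ∀ v₁ ∈ L₂, ∀ v₂ ∈ L₂, ∀ v₃ ∈ L₂,
      val π₂ v₁ = φ (val π₁ u₁) → val π₂ v₂ = φ (val π₁ u₂) → val π₂ v₃ = φ (val π₁ u₃) →
      MFT π₁ p (u₁ ++ u₂) u₃ → MFT π₂ q (v₁ ++ v₂) v₃

section HyperbolicBRP

/-! The seven formulations of the hyperbolic bounded reduction property of an endomorphism. A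
geodesic of `Γ_A(G)` is given by its starting vertex and its label, a word in `Geo π`. -/

variable {G : Type*} [Group G] {A : Type*} (π : FreeMonoid A →* G) (φ : G →* G)

/-- Formulation (i): quasi-geodesic concatenations are mapped to quasi-geodesic concatenations. -/
def HypBRPQuasi : Prop :=
  ∀ p : ℝ, 0 ≤ p → ∃ q : ℝ, 0 ≤ q ∧
    ∀ u ∈ Geo π, ∀ v ∈ Geo π, IsQuasiGeodesic π 1 p (u ++ v) →
      ∀ α ∈ Geo π, ∀ β ∈ Geo π, val π α = φ (val π u) → val π β = φ (val π v) →
        IsQuasiGeodesic π 1 q (α ++ β)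

/-- Formulation (ii): geodesic concatenations are mapped to quasi-geodesic concatenations. -/
def HypBRPGeo : Prop :=
  ∃ q : ℝ, 0 ≤ q ∧
    ∀ u ∈ Geo π, ∀ v ∈ Geo π, u ++ v ∈ Geo π →
      ∀ α ∈ Geo π, ∀ β ∈ Geo π, val π α = φ (val π u) → val π β = φ (val π v) →
        IsQuasiGeodesic π 1 q (α ++ β)

/-- Formulation (iii): bounded Gromov products have bounded image. -/
def HypBRPGromov : Prop :=
  ∀ p : ℝ, 0 < p → ∃ q : ℝ, 0 < q ∧
    ∀ u v : G, gromovProduct (gens π) 1 u v ≤ p → gromovProduct (gens π) 1 (φ u) (φ v) ≤ q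

/-- Formulation (iv): pairs with zero Gromov product have images with bounded Gromov product. -/
def HypBRPGromovZero : Prop :=
  ∃ q : ℝ, 0 < q ∧
    ∀ u v : G, gromovProduct (gens π) 1 u v = 0 → gromovProduct (gens π) 1 (φ u) (φ v) ≤ q

/-- Formulation (v): the image of every geodesic `[x, y]` is at Hausdorff distance at most `N` from
every geodesic `[xφ, yφ]`. -/
def HypBRPHausdorff : Prop :=
  ∃ N : ℕ, ∀ x : G, ∀ α ∈ Geo π, ∀ ξ ∈ Geo π, val π ξ = φ (val π α) →
    φ '' pathSet π x α ⊆ nbhd π N (pathSet π (φ x) ξ) ∧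
    pathSet π (φ x) ξ ⊆ nbhd π N (φ '' pathSet π x α)

/-- Formulation (vi): the image of every geodesic `[x, y]` lies in the `N`-neighbourhood of every
geodesic `[xφ, yφ]`. -/
def HypBRPNbhd : Prop :=
  ∃ N : ℕ, ∀ x : G, ∀ α ∈ Geo π, ∀ ξ ∈ Geo π, val π ξ = φ (val π α) →
    φ '' pathSet π x α ⊆ nbhd π N (pathSet π (φ x) ξ)

/-- Formulation (vii): `φ` preserves the coarse median structure of the hyperbolic group. -/
def CoarseMedianPreserving : Prop :=
  ∃ μ : G → G → G → G, IsCoarseMedian π μ ∧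
    ∃ C : ℕ, ∀ x y z : G, dist π (φ (μ x y z)) (μ (φ x) (φ y) (φ z)) ≤ C

end HyperbolicBRP

end BRP

/-! ### Hyperbolic graph metrics: edge paths and half of the Morse lemma. -/

namespace BRP

/-! All eight conditions say that `φ` sends bounded Gromov products to bounded Gromov products, at
every base point (`ImageGPBounded`). In a hyperbolic metric the product `(x|y)_w` is, up to a
bounded error, the distance from `w` to any geodesic `[x,y]` (`mem_nbhd_of_gp_le`,
`gp_le_of_mem_nbhd`). For geodesic words `u`, `v`, the product of `u⁻¹` and `v` at `1` is half the
length lost in the concatenation `uv`. Its boundedness amounts to `uv` being a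
`(1,q)`-quasi-geodesic, and also to `uv` fellow travelling with a geodesic. This settles FT-BRP and
(i)–(iv). A point on a geodesic `[x,y]` has product zero with `x`, `y`, which links (iv) to (vi).
Conditions (v) and (vii) follow by a crossing argument along the geodesic and by uniqueness of
coarse medians up to bounded error; the Lipschitz bound on `φ` enters in the implications leaving
(vi) and in the one from (vii) to (vi).

Hyperbolicity is given for some finite generating set, so it must first be moved to `A`. The two
word metrics are bilipschitz. Half of the Morse lemma (`exists_near_edgePath`) shows that bounded
products for one metric are bounded for the other, so coarse medians are shared. The four point
inequality can be expressed through coarse medians, hence it transfers. -/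

/-- The path metric of a connected graph, as a natural-number valued function: a metric with
intermediate points at every integer distance. -/
structure IsGraphMetric {X : Type*} (d : X → X → ℕ) : Prop where
  self : ∀ x, d x x = 0
  eq_of_zero : ∀ {x y}, d x y = 0 → x = y
  symm : ∀ x y, d x y = d y x
  tri : ∀ x y z, d x z ≤ d x y + d y z
  between : ∀ x y t, t ≤ d x y → ∃ m, d x m = t ∧ d m y + t = d x y

/-- The Gromov product `(x | y)_w` for the distance `d`. -/
noncomputable def gp {X : Type*} (d : X → X → ℕ) (w x y : X) : ℝ :=
  ((d w x : ℝ) + (d w y : ℝ) - (d x y : ℝ)) / 2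

/-- Gromov's four point condition with constant `δ`. -/
def FourPoint {X : Type*} (d : X → X → ℕ) (δ : ℝ) : Prop :=
  ∀ w x y z, min (gp d w x y) (gp d w y z) - δ ≤ gp d w x z

/-- A unit speed edge path of length `n` from `x` to `y` that stays at `y` afterwards. -/
structure IsEdgePath {X : Type*} (d : X → X → ℕ) (x y : X) (n : ℕ) (γ : ℕ → X) : Prop where
  zero : γ 0 = x
  last : ∀ i, n ≤ i → γ i = y
  step : ∀ i, d (γ i) (γ (i + 1)) ≤ 1

section

variable {X : Type*} {d d' : X → X → ℕ}

namespace IsGraphMetric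

theorem triR (h : IsGraphMetric d) (x y z : X) : (d x z : ℝ) ≤ d x y + d y z := by
  exact_mod_cast h.tri x y z

theorem symmR (h : IsGraphMetric d) (x y : X) : (d x y : ℝ) = d y x := by
  exact_mod_cast h.symm x y

theorem gp_symm (h : IsGraphMetric d) (w x y : X) : gp d w x y = gp d w y x := by
  have := h.symmR x y
  unfold gp
  linarith

theorem gp_le (h : IsGraphMetric d) (w x y : X) : gp d w x y ≤ d w x := by
  have := h.triR w x y
  unfold gp
  linarith

theorem gp_nonneg (h : IsGraphMetric d) (w x y : X) : 0 ≤ gp d w x y := by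
  have := h.triR x w y
  have := h.symmR x w
  unfold gp
  linarith

theorem nonneg_of_fourPoint (h : IsGraphMetric d) {δ : ℝ} (hδ : FourPoint d δ) (x : X) :
    0 ≤ δ := by
  have := hδ x x x x
  simp [gp, h.self] at this
  exact this

theorem exists_edgePath (h : IsGraphMetric d) (n : ℕ) :
    ∀ x y, d x y = n → ∃ γ, IsEdgePath d x y n γ := by
  induction n with
  | zero =>
    intro x y hxy
    obtain rfl := h.eq_of_zero hxy
    exact ⟨fun _ => x, rfl, fun _ _ => rfl, fun _ => by simp [h.self]⟩
  | succ n ih =>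
    intro x y hxy
    obtain ⟨m, h1, h2⟩ := h.between x y 1 (by omega)
    obtain ⟨γ, hγ⟩ := ih m y (by omega)
    refine ⟨fun i => Nat.casesOn i x γ, rfl, ?_, ?_⟩
    · rintro (_ | i) hi
      · omega
      · exact hγ.last i (by omega)
    · rintro (_ | i)
      · change d x (γ 0) ≤ 1
        rw [hγ.zero]
        omega
      · exact hγ.step i

theorem lipschitz {Y : Type*} {e : Y → Y → ℕ} (h : IsGraphMetric d) (he : IsGraphMetric e)
    (f : X → Y) (L : ℕ) (hf : ∀ x y, d x y = 1 → e (f x) (f y) ≤ L) (x y : X) :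
    e (f x) (f y) ≤ L * d x y := by
  suffices ∀ n x y, d x y = n → e (f x) (f y) ≤ L * n from this _ x y rfl
  intro n
  induction n with
  | zero =>
    intro x y hxy
    rw [h.eq_of_zero hxy, he.self]
    omega
  | succ n ih =>
    intro x y hxy
    obtain ⟨m, h1, h2⟩ := h.between x y 1 (by omega)
    have := hf x m h1
    have := ih m y (by omega)
    have := he.tri (f x) (f m) (f y)
    rw [mul_add]
    omega

end IsGraphMetric

namespace IsEdgePath

variable {x y : X} {n : ℕ} {γ : ℕ → X}

theorem dist_le (hγ : IsEdgePath d x y n γ) (h : IsGraphMetric d) (i k : ℕ) :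
    d (γ i) (γ (i + k)) ≤ k := by
  induction k with
  | zero => simp [h.self]
  | succ k ih =>
    have := hγ.step (i + k)
    have := h.tri (γ i) (γ (i + k)) (γ (i + (k + 1)))
    rw [← add_assoc] at *
    omega

theorem dist_eq (hγ : IsEdgePath d x y (d x y) γ) (h : IsGraphMetric d) {i j : ℕ}
    (hij : i ≤ j) (hj : j ≤ d x y) : d (γ i) (γ j) = j - i := by
  have h1 := hγ.dist_le h 0 i
  have h2 := hγ.dist_le h i (j - i)
  have h3 := hγ.dist_le h j (d x y - j)
  rw [show j + (d x y - j) = d x y by omega, hγ.last _ le_rfl] at h3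
  rw [show i + (j - i) = j by omega] at h2
  rw [zero_add, hγ.zero] at h1
  have h4 := h.tri x (γ i) y
  have h5 := h.tri (γ i) (γ j) y
  omega

theorem between (hγ : IsEdgePath d x y (d x y) γ) (h : IsGraphMetric d) (i : ℕ) :
    d x (γ i) + d (γ i) y = d x y := by
  rcases le_total i (d x y) with hi | hi
  · have h1 := hγ.dist_eq h (Nat.zero_le i) hi
    have h2 := hγ.dist_eq h hi le_rfl
    rw [hγ.last _ le_rfl] at h2
    rw [hγ.zero] at h1
    omega
  · simp [hγ.last i hi, h.self]

end IsEdgePath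

/-- Along a sequence of at most `2 ^ k` steps the four point condition loses at most `k * δ`. -/
theorem FourPoint.chain {δ : ℝ} (hδ : FourPoint d δ) (h : IsGraphMetric d) {w : X} {p : ℕ → X}
    {B : ℝ} (hB : ∀ i, B ≤ gp d w (p i) (p (i + 1))) (k : ℕ) :
    ∀ i n, n ≤ 2 ^ k → B - k * δ ≤ gp d w (p i) (p (i + n)) := by
  have hδ0 := h.nonneg_of_fourPoint hδ w
  have h0 : ∀ k : ℕ, ∀ i, B - k * δ ≤ gp d w (p i) (p i) := by
    intro k i
    have h1 := hB i
    have h2 := h.gp_le w (p i) (p (i + 1))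
    have h3 : gp d w (p i) (p i) = d w (p i) := by simp [gp, h.self]
    have : 0 ≤ (k : ℝ) * δ := by positivity
    linarith
  induction k with
  | zero =>
    intro i n hn
    have : n = 0 ∨ n = 1 := by
      simp at hn
      omega
    rcases this with rfl | rfl
    · exact h0 0 i
    · simpa using hB i
  | succ k ih =>
    intro i n hn
    rcases le_total n (2 ^ k) with hn' | hn'
    · have := ih i n hn'
      push_cast
      linarith
    -- Bisection: both halves have at most `2 ^ k` steps, and joining them costs one more `δ`.
    · have h1 := ih i (2 ^ k) le_rfl
      have h2 := ih (i + 2 ^ k) (n - 2 ^ k) (by rw [pow_succ] at hn; omega)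
      rw [show i + 2 ^ k + (n - 2 ^ k) = i + n by omega] at h2
      have h3 := hδ w (p i) (p (i + 2 ^ k)) (p (i + n))
      have h4 := le_min h1 h2
      push_cast
      linarith

/-- Exponential growth beats linear growth: the hypothesis says that `D` is at most about `a + b *
log₂ (M * D)`. -/
theorem exists_bound_of_le_log (M : ℕ) (a b : ℝ) :
    ∃ D₀ : ℕ, ∀ D : ℕ, (∀ k : ℕ, M * D ≤ 2 ^ k → (D : ℝ) ≤ a + k * b) → D ≤ D₀ := by
  have ht : Filter.Tendsto (fun k : ℕ => (k : ℝ) ^ 1 / (2 : ℝ) ^ k) Filter.atTop (nhds 0) :=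
    tendsto_pow_const_div_const_pow_of_one_lt 1 (by norm_num)
  have hc : Filter.Tendsto (fun k : ℕ => (1 : ℝ) / (2 : ℝ) ^ k) Filter.atTop (nhds 0) := by
    simpa using tendsto_pow_const_div_const_pow_of_one_lt 0 (show (1 : ℝ) < 2 by norm_num)
  have hsum : Filter.Tendsto (fun k : ℕ => (M * (a + (k + 1) * b)) / (2 : ℝ) ^ k)
      Filter.atTop (nhds 0) := by
    have := (ht.const_mul (M * b)).add (hc.const_mul (M * (a + b)))
    simp only [mul_zero, add_zero] at this
    refine this.congr fun k => ?_
    ring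
  obtain ⟨K, hK⟩ := Filter.eventually_atTop.1 (hsum.eventually_lt_const one_pos)
  refine ⟨⌈a + K * b⌉₊, fun D hD => ?_⟩
  suffices M * D ≤ 2 ^ K by
    exact_mod_cast (hD K this).trans (Nat.le_ceil _)
  by_contra hlt
  have hex : ∃ k, M * D ≤ 2 ^ (K + k) :=
    ⟨M * D, (Nat.lt_two_pow_self.le).trans (Nat.pow_le_pow_right (by norm_num) (by omega))⟩
  classical
  -- The least power of two above `M * D` is within a factor of two of it; past `K` such powers
  -- outgrow the linear bound.
  obtain ⟨k, hk, hmin⟩ : ∃ k, M * D ≤ 2 ^ (K + (k + 1)) ∧ ¬ M * D ≤ 2 ^ (K + k) := by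
    have h1 := Nat.find_spec hex
    rcases hf : Nat.find hex with _ | k
    · rw [hf] at h1
      exact absurd h1 hlt
    · rw [hf] at h1
      exact ⟨k, h1, Nat.find_min hex (by omega)⟩
  have h1 := hD _ hk
  have h2 := hK (K + k) (by omega)
  rw [div_lt_one (by positivity)] at h2
  have h3 : (M : ℝ) * D ≤ M * (a + ((K + k : ℕ) + 1) * b) := by
    refine mul_le_mul_of_nonneg_left ?_ (by positivity)
    push_cast at h1 ⊢
    linarith
  refine hmin ?_
  have : (M : ℝ) * D ≤ 2 ^ (K + k) := h3.trans h2.le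
  exact_mod_cast this

/-- Half of the Morse lemma: `d`-geodesics stay close to `d'`-geodesics with the same endpoints,
if `d` is hyperbolic and the two metrics are bilipschitz equivalent. -/
theorem exists_near_edgePath (h : IsGraphMetric d) (h' : IsGraphMetric d') {δ : ℝ}
    (hδ : FourPoint d δ) {L : ℕ} (hL : ∀ x y, d x y ≤ L * d' x y)
    (hL' : ∀ x y, d' x y ≤ L * d x y) :
    ∃ D₀ : ℕ, ∀ x y γ, IsEdgePath d' x y (d' x y) γ →
      ∀ w, d x w + d w y = d x y → ∃ i, d w (γ i) ≤ D₀ := by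
  -- With `D` the largest distance from the `d`-interval to `γ`, a detour along `γ` takes at most `6
  -- * L * D` steps. `L / 2` is lost on each edge of `γ`, `k * δ` along the detour and `2 * δ` in
  -- joining its ends.
  obtain ⟨D₀, hD₀⟩ := exists_bound_of_le_log (6 * L) (L / 2 + 2 * δ) δ
  refine ⟨D₀, fun x y γ hγ => ?_⟩
  set f : X → ℕ := fun w => sInf (Set.range fun i => d w (γ i)) with hf
  have f_le : ∀ w i, f w ≤ d w (γ i) := fun w i => Nat.sInf_le ⟨i, rfl⟩
  have f_eq : ∀ w, ∃ i, i ≤ d' x y ∧ d w (γ i) = f w := by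
    intro w
    obtain ⟨i, hi⟩ := Nat.sInf_mem (Set.range_nonempty fun i => d w (γ i))
    rcases le_total i (d' x y) with hin | hin
    · exact ⟨i, hin, hi⟩
    · refine ⟨d' x y, le_rfl, ?_⟩
      rw [hγ.last _ le_rfl, ← hγ.last i hin]
      exact hi
  obtain ⟨w, hw, hmax⟩ : ∃ w, d x w + d w y = d x y ∧
      ∀ v, d x v + d v y = d x y → f v ≤ f w := by
    have hne : (f '' {w | d x w + d w y = d x y}).Nonempty := ⟨f x, x, by simp [h.self], rfl⟩
    have hbd : BddAbove (f '' {w | d x w + d w y = d x y}) := by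
      refine ⟨d x y, ?_⟩
      rintro _ ⟨v, hv, rfl⟩
      have h1 := f_le v 0
      rw [hγ.zero, h.symm] at h1
      have hv' : d x v + d v y = d x y := hv
      omega
    obtain ⟨w, hw, hw'⟩ := Nat.sSup_mem hne hbd
    exact ⟨w, hw, fun v hv => hw' ▸ le_csSup hbd ⟨v, hv, rfl⟩⟩
  set D := f w with hD
  suffices D ≤ D₀ by
    intro v hv
    obtain ⟨i, -, hi⟩ := f_eq v
    exact ⟨i, by have := hmax v hv; omega⟩
  refine hD₀ D fun k hk => ?_
  -- From the worst point `w`, go `2 * D` towards an end `e`, or to `e` if it is nearer, then jump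
  -- at most `D` to `γ`. The jump keeps product at least `D` based at `w`, because `γ` stays `D`
  -- away from `w`.
  have key : ∀ e i₀, i₀ ≤ d' x y → γ i₀ = e →
      (∀ u, d e u + d u w = d e w → d x u + d u y = d x y) →
      ∃ u i, i ≤ d' x y ∧ d w u ≤ 2 * D ∧ d e u + d u w = d e w ∧ d u (γ i) ≤ D ∧
        (D : ℝ) ≤ gp d w u (γ i) := by
    intro e i₀ hi₀ he hI
    rcases le_total (2 * D) (d e w) with hc | hc
    · obtain ⟨u, h1, h2⟩ := h.between w e (2 * D) (by rwa [h.symm])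
      have h3 : d e u + d u w = d e w := by
        rw [h.symm e u, h.symm u w, h.symm e w]
        omega
      obtain ⟨i, hi, hi'⟩ := f_eq u
      have h4 := hmax u (hI u h3)
      have h5 : d u (γ i) ≤ D := by omega
      refine ⟨u, i, hi, h1.le, h3, h5, ?_⟩
      have h6 : (D : ℝ) ≤ d w (γ i) := by exact_mod_cast f_le w i
      have h5' : (d u (γ i) : ℝ) ≤ D := by exact_mod_cast h5
      have h7 : (d w u : ℝ) = 2 * D := by exact_mod_cast h1
      unfold gp
      linarith
    · refine ⟨e, i₀, hi₀, by rw [h.symm]; omega, by simp [h.self], by simp [he, h.self], ?_⟩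
      have h6 : (D : ℝ) ≤ d w (γ i₀) := by exact_mod_cast f_le w i₀
      rw [he] at h6 ⊢
      simpa [gp, h.self] using h6
  obtain ⟨u₁, i, hi, a1, a2, a3, a4⟩ := key x 0 (Nat.zero_le _) hγ.zero (by
    intro u hu
    have := h.tri u w y
    have := h.tri x u y
    omega)
  obtain ⟨u₂, j, hj, b1, b2, b3, b4⟩ := key y (d' x y) le_rfl (hγ.last _ le_rfl) (by
    intro u hu
    have := h.tri x w u
    have := h.tri x u y
    have := h.symm u w
    have := h.symm y u
    have := h.symm y w
    omega)
  have hij : d (γ i) (γ j) ≤ 6 * D := by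
    have := h.tri (γ i) u₁ (γ j)
    have := h.tri u₁ w (γ j)
    have := h.tri w u₂ (γ j)
    have := h.symm (γ i) u₁
    have := h.symm u₁ w
    omega
  -- `w` lies between `u₁` and `u₂`, whereas the detour through `γ` bounds the same product below.
  have hzero : gp d w u₁ u₂ ≤ 0 := by
    have c1 : d w u₁ + d w u₂ ≤ d u₁ u₂ := by
      have := h.tri x u₁ y
      have := h.tri u₁ u₂ y
      have := h.symm u₁ w
      have := h.symm u₂ w
      have := h.symm y u₂
      have := h.symm y w
      omega
    have c2 : (d w u₁ : ℝ) + d w u₂ ≤ d u₁ u₂ := by exact_mod_cast c1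
    unfold gp
    linarith
  have hB : ∀ i, (D : ℝ) - L / 2 ≤ gp d w (γ i) (γ (i + 1)) := by
    intro i
    have c1 : d (γ i) (γ (i + 1)) ≤ L :=
      (hL _ _).trans ((Nat.mul_le_mul_left L (hγ.step i)).trans (by omega))
    have c1' : (d (γ i) (γ (i + 1)) : ℝ) ≤ L := by exact_mod_cast c1
    have c2 : (D : ℝ) ≤ d w (γ i) := by exact_mod_cast f_le w i
    have c3 : (D : ℝ) ≤ d w (γ (i + 1)) := by exact_mod_cast f_le w (i + 1)
    unfold gp
    linarith
  have hlen : d' (γ i) (γ j) ≤ 2 ^ k :=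
    (hL' _ _).trans ((Nat.mul_le_mul_left L hij).trans (by
      refine le_trans (le_of_eq ?_) hk
      ring))
  have hmid : (D : ℝ) - L / 2 - k * δ ≤ gp d w (γ i) (γ j) := by
    rcases le_total i j with hle | hle
    · have := hδ.chain h hB k i (j - i) (by rwa [← hγ.dist_eq h' hle hj])
      rwa [show i + (j - i) = j by omega] at this
    · have := hδ.chain h hB k j (i - j) (by rwa [← hγ.dist_eq h' hle hi, h'.symm])
      rwa [show j + (i - j) = i by omega, h.gp_symm] at this
  have hδ0 := h.nonneg_of_fourPoint hδ w
  have e1 := hδ w u₁ (γ i) u₂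
  have e2 := hδ w (γ i) (γ j) u₂
  rw [h.gp_symm w u₂] at b4
  have hk0 : 0 ≤ (k : ℝ) * δ := by positivity
  have hL0 : (0 : ℝ) ≤ L := by positivity
  have e3 : (D : ℝ) - L / 2 - k * δ ≤ min (gp d w (γ i) (γ j)) (gp d w (γ j) u₂) :=
    le_min hmid (by linarith)
  have e4 : (D : ℝ) - L / 2 - k * δ - δ ≤ min (gp d w u₁ (γ i)) (gp d w (γ i) u₂) :=
    le_min (by linarith) (by linarith)
  linarith

/-! ### Projections, coarse medians and bilipschitz invariance of hyperbolicity. -/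

/-- Every point is close to a geodesic up to its Gromov product, at a point that is also a coarse
median of the three points. -/
theorem FourPoint.exists_projection {δ : ℝ} (hδ : FourPoint d δ) (h : IsGraphMetric d)
    (x y w : X) :
    ∃ t, t ≤ d x y ∧ ∀ m, d x m = t → d m y + t = d x y →
      (d w m : ℝ) ≤ gp d w x y + 1 + 2 * δ ∧ gp d m x w ≤ δ + 1 ∧ gp d m y w ≤ δ + 1 := by
  have hg := h.gp_nonneg x y w
  have hfl := Nat.floor_le hg
  have hlt := Nat.lt_floor_add_one (gp d x y w)
  -- The branching point of the tripod, seen from `x`; rounding down to a vertex costs the `1` in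
  -- the bounds.
  set t := ⌊gp d x y w⌋₊ with ht
  have htd : (t : ℝ) ≤ d x y := hfl.trans (h.gp_le _ _ _)
  refine ⟨t, by exact_mod_cast htd, fun m h1 h2 => ?_⟩
  have h1' : (d x m : ℝ) = t := by exact_mod_cast h1
  have h2' : (d m y : ℝ) + t = d x y := by exact_mod_cast h2
  have h3 : (t : ℝ) ≤ gp d x m y := by
    unfold gp
    linarith
  have h4 := hδ x m y w
  have h5 := le_min h3 hfl
  have h6 : (t : ℝ) - δ ≤ gp d x m w := by linarith
  have s1 := h.symmR x m
  have s2 := h.symmR m w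
  have s3 := h.symmR y m
  have s4 := h.symmR w x
  have s5 := h.symmR w y
  unfold gp at *
  refine ⟨?_, ?_, ?_⟩ <;> linarith

theorem FourPoint.exists_median {δ : ℝ} (hδ : FourPoint d δ) (h : IsGraphMetric d)
    (x y w : X) : ∃ m, gp d m x y ≤ δ + 1 ∧ gp d m x w ≤ δ + 1 ∧ gp d m y w ≤ δ + 1 := by
  obtain ⟨t, ht, H⟩ := hδ.exists_projection h x y w
  obtain ⟨m, h1, h2⟩ := h.between x y t ht
  obtain ⟨-, h3, h4⟩ := H m h1 h2
  refine ⟨m, ?_, h3, h4⟩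
  have h1' : (d x m : ℝ) = t := by exact_mod_cast h1
  have h2' : (d m y : ℝ) + t = d x y := by exact_mod_cast h2
  have := h.symmR x m
  have := h.nonneg_of_fourPoint hδ x
  unfold gp
  linarith

theorem gp_le_of_between (h : IsGraphMetric d) {x y m : X} (hm : d x m + d m y = d x y) (w : X) :
    gp d w x y ≤ d w m := by
  have h1 : (d x m : ℝ) + d m y = d x y := by exact_mod_cast hm
  have := h.triR w m x
  have := h.triR w m y
  have := h.symmR m x
  unfold gp
  linarith

/-- A small product puts `w` near a `d`-geodesic, which is near a `d'`-geodesic by the Morse half.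
The product is at most the distance to any point of the latter. -/
theorem exists_gp_bound (h : IsGraphMetric d) (h' : IsGraphMetric d') {δ : ℝ}
    (hδ : FourPoint d δ) {L : ℕ} (hL : ∀ x y, d x y ≤ L * d' x y)
    (hL' : ∀ x y, d' x y ≤ L * d x y) (c : ℝ) :
    ∃ c' : ℝ, ∀ w x y, gp d w x y ≤ c → gp d' w x y ≤ c' := by
  obtain ⟨D₀, hD₀⟩ := exists_near_edgePath h h' hδ hL hL'
  refine ⟨L * (c + 1 + 2 * δ + D₀), fun w x y hw => ?_⟩
  obtain ⟨t, ht, H⟩ := hδ.exists_projection h x y w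
  obtain ⟨m, h1, h2⟩ := h.between x y t ht
  obtain ⟨h3, -, -⟩ := H m h1 h2
  obtain ⟨γ, hγ⟩ := h'.exists_edgePath _ x y rfl
  obtain ⟨i, hi⟩ := hD₀ x y γ hγ m (by omega)
  refine (gp_le_of_between h' (hγ.between h' i) w).trans ?_
  have h4 : (d' w (γ i) : ℝ) ≤ L * d w (γ i) := by exact_mod_cast hL' _ _
  have h5 := h.triR w m (γ i)
  have hi' : (d m (γ i) : ℝ) ≤ D₀ := by exact_mod_cast hi
  exact h4.trans (mul_le_mul_of_nonneg_left (by linarith) (by positivity))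

/-- The Gromov product is the distance to a coarse median, up to a bounded error. -/
theorem gp_sub_dist_le (h : IsGraphMetric d) {w x y m : X} {c : ℝ} (h1 : gp d m x y ≤ c)
    (h2 : gp d m x w ≤ c) (h3 : gp d m y w ≤ c) :
    gp d w x y ≤ d w m + c ∧ (d w m : ℝ) ≤ gp d w x y + 2 * c := by
  have s1 := h.symmR w m
  have s2 := h.symmR w x
  have s3 := h.symmR w y
  have t1 := h.triR x m y
  have t2 := h.triR w m x
  have t3 := h.triR w m y
  have s4 := h.symmR x m
  unfold gp at *
  constructor <;> linarith

/-- Gromov hyperbolicity is invariant under bilipschitz changes of the graph metric. -/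
theorem FourPoint.of_bilipschitz (h : IsGraphMetric d) (h' : IsGraphMetric d') {δ : ℝ}
    (hδ : FourPoint d δ) {L : ℕ} (hL : ∀ x y, d x y ≤ L * d' x y)
    (hL' : ∀ x y, d' x y ≤ L * d x y) : ∃ δ' : ℝ, FourPoint d' δ' := by
  obtain ⟨c₁, hc₁⟩ := exists_gp_bound h h' hδ hL hL' (δ + 1)
  obtain ⟨c₂, hc₂⟩ := exists_gp_bound h h' hδ hL hL' (5 * (δ + 1) + 2 * δ)
  -- The medians `m` of `x, y, w` and `m'` of `x, z, w` both lie near `[w,x]`, with `m` no farther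
  -- out up to a constant. So `gp d m w m'` is bounded, hence also `gp d' m w m'`, which orders the
  -- distances from `w` for `d'` too.
  have key : ∀ w x y z, gp d w x y - δ ≤ gp d w x z →
      gp d' w x y - (3 * c₁ + 2 * c₂) ≤ gp d' w x z := by
    intro w x y z hle
    obtain ⟨m, a1, a2, a3⟩ := hδ.exists_median h x y w
    obtain ⟨m', b1, b2, b3⟩ := hδ.exists_median h x z w
    obtain ⟨-, a4⟩ := gp_sub_dist_le h a1 a2 a3
    obtain ⟨b4, -⟩ := gp_sub_dist_le h b1 b2 b3
    obtain ⟨a5, -⟩ := gp_sub_dist_le h' (hc₁ _ _ _ a1) (hc₁ _ _ _ a2) (hc₁ _ _ _ a3)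
    obtain ⟨-, b5⟩ := gp_sub_dist_le h' (hc₁ _ _ _ b1) (hc₁ _ _ _ b2) (hc₁ _ _ _ b3)
    have hδ0 := h.nonneg_of_fourPoint hδ w
    have e1 : (d w m : ℝ) - 4 * (δ + 1) - δ ≤ gp d w m x := by
      have := h.symmR x m
      have := h.symmR w m
      have := h.symmR w x
      unfold gp at *
      linarith
    have e2 : (d w m : ℝ) - 4 * (δ + 1) - δ ≤ gp d w x m' := by
      have : (d w m' : ℝ) - (δ + 1) ≤ gp d w x m' := by
        have := h.symmR x m'
        have := h.symmR w m'
        have := h.symmR w x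
        unfold gp at *
        linarith
      linarith
    have e3 := hδ w m x m'
    have e4 := le_min e1 e2
    have e5 : gp d m w m' ≤ 5 * (δ + 1) + 2 * δ := by
      have := h.symmR w m
      have e6 : (d w m : ℝ) - 4 * (δ + 1) - δ - δ ≤ gp d w m m' := by linarith
      unfold gp at e6 ⊢
      linarith
    have e7 := hc₂ _ _ _ e5
    have e8 : (d' w m : ℝ) - 2 * c₂ ≤ d' w m' := by
      have := h'.symmR w m
      have := h'.triR w m' m
      have := h'.symmR m m'
      have := h'.triR m w m'
      have : (0:ℝ) ≤ d' m m' := by positivity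
      unfold gp at e7
      linarith
    linarith
  refine ⟨3 * c₁ + 2 * c₂, fun w x y z => ?_⟩
  have h0 := hδ w x y z
  rcases le_total (gp d w x y) (gp d w y z) with hle | hle
  · rw [min_eq_left hle] at h0
    have := key w x y z h0
    have := min_le_left (gp d' w x y) (gp d' w y z)
    linarith
  · rw [min_eq_right hle, h.gp_symm w y z, h.gp_symm w x z] at h0
    have := key w z y x h0
    have := min_le_right (gp d' w x y) (gp d' w y z)
    rw [h'.gp_symm w x z, h'.gp_symm w y z] at *
    linarith

end

end BRP

/-! ### Word metrics on Cayley graphs. -/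

namespace BRP

section

variable {G : Type*} [Group G]

theorem reachable_mulCayley {S : Set G} (hS : Subgroup.closure S = ⊤) (x y : G) :
    (SimpleGraph.mulCayley S).Reachable x y := by
  suffices ∀ g ∈ Subgroup.closure S, ∀ x, (SimpleGraph.mulCayley S).Reachable x (x * g) by
    simpa using this (x⁻¹ * y) (hS ▸ Subgroup.mem_top _) x
  intro g hg
  induction hg using Subgroup.closure_induction with
  | mem g hg =>
    intro x
    by_cases h : x = x * g
    · rw [← h]
    · exact SimpleGraph.Adj.reachable ((SimpleGraph.mulCayley_adj S _ _).2 ⟨h, by simp [hg]⟩)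
  | one => simp
  | mul a b _ _ ha hb =>
    intro x
    rw [← mul_assoc]
    exact (ha x).trans (hb _)
  | inv a _ ha =>
    intro x
    simpa using (ha (x * a⁻¹)).symm

theorem isGraphMetric_cayleyDist {S : Set G} (hS : Subgroup.closure S = ⊤) :
    IsGraphMetric (cayleyDist S) where
  self x := SimpleGraph.dist_self
  eq_of_zero h := (reachable_mulCayley hS _ _).dist_eq_zero_iff.1 h
  symm x y := SimpleGraph.dist_comm
  tri x y z := (reachable_mulCayley hS x y).dist_triangle_left z
  between x y t ht := by
    obtain ⟨p, hp⟩ := (reachable_mulCayley hS x y).exists_walk_length_eq_dist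
    have h1 := SimpleGraph.dist_le (p.take t)
    have h2 := SimpleGraph.dist_le (p.drop t)
    rw [SimpleGraph.Walk.take_length] at h1
    rw [SimpleGraph.Walk.drop_length] at h2
    have h3 := (reachable_mulCayley hS x (p.getVert t)).dist_triangle_left y
    refine ⟨p.getVert t, ?_⟩
    unfold cayleyDist at *
    omega

theorem cayleyDist_mul_left {S : Set G} (hS : Subgroup.closure S = ⊤) (g x y : G) :
    cayleyDist S (g * x) (g * y) = cayleyDist S x y := by
  have h := isGraphMetric_cayleyDist hS
  have key : ∀ g x y : G, cayleyDist S (g * x) (g * y) ≤ cayleyDist S x y := by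
    intro g x y
    refine (h.lipschitz h (g * ·) 1 (fun x y hxy => ?_) x y).trans (by omega)
    unfold cayleyDist at *
    rw [SimpleGraph.dist_eq_one_iff_adj] at hxy
    exact (SimpleGraph.dist_eq_one_iff_adj.2 (SimpleGraph.mulCayley_adj_mul_iff_right.2 hxy)).le
  refine le_antisymm (key g x y) ?_
  simpa using key g⁻¹ (g * x) (g * y)

/-- A group homomorphism is Lipschitz for word metrics with a finite generating set on the
source. -/
theorem exists_lipschitz {H : Type*} [Group H] {S : Set G} (hfin : S.Finite)
    (hS : Subgroup.closure S = ⊤) {T : Set H} (hT : Subgroup.closure T = ⊤) (f : G →* H) :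
    ∃ L : ℕ, ∀ x y, cayleyDist T (f x) (f y) ≤ L * cayleyDist S x y := by
  obtain ⟨L, hL⟩ := (hfin.image fun s => cayleyDist T 1 (f s)).bddAbove
  have h := isGraphMetric_cayleyDist hS
  have h' := isGraphMetric_cayleyDist hT
  refine ⟨L, h.lipschitz h' f L fun x y hxy => ?_⟩
  have hmul : ∀ x y, x⁻¹ * y ∈ S → cayleyDist T (f x) (f y) ≤ L := by
    intro x y hxy
    rw [← cayleyDist_mul_left hT (f x)⁻¹, inv_mul_cancel, ← map_inv, ← map_mul]
    exact hL ⟨_, hxy, rfl⟩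
  unfold cayleyDist at hxy
  rw [SimpleGraph.dist_eq_one_iff_adj, SimpleGraph.mulCayley_adj] at hxy
  rcases hxy.2 with h1 | h1
  · exact hmul x y h1
  · rw [h'.symm]
    exact hmul y x h1

end

/-! ### Words, edge paths and geodesic labels. -/

section

variable {G : Type*} [Group G] {A : Type*} {π : FreeMonoid A →* G}

theorem val_nil : val π [] = 1 := map_one π

theorem val_append (u v : List A) : val π (u ++ v) = val π u * val π v := map_mul π _ _

theorem val_cons (a : A) (u : List A) : val π (a :: u) = π (FreeMonoid.of a) * val π u :=
  map_mul π (FreeMonoid.of a) (FreeMonoid.ofList u)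

theorem closure_gens (hπ : Function.Surjective π) : Subgroup.closure (gens π) = ⊤ := by
  refine eq_top_iff.2 fun g _ => ?_
  obtain ⟨w, rfl⟩ := hπ g
  induction w using FreeMonoid.recOn with
  | one => simp
  | of_mul a w hw =>
    rw [map_mul]
    exact mul_mem (Subgroup.subset_closure ⟨a, rfl⟩) (hw trivial)

theorem isGraphMetric_dist (hπ : Function.Surjective π) : IsGraphMetric (dist π) :=
  isGraphMetric_cayleyDist (closure_gens hπ)

theorem dist_mul_left (hπ : Function.Surjective π) (g x y : G) :
    dist π (g * x) (g * y) = dist π x y :=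
  cayleyDist_mul_left (closure_gens hπ) g x y

theorem gp_mul_left (hπ : Function.Surjective π) (g w x y : G) :
    gp (dist π) (g * w) (g * x) (g * y) = gp (dist π) w x y := by
  simp only [gp, dist_mul_left hπ]

theorem gp_eq_one (hπ : Function.Surjective π) (w x y : G) :
    gp (dist π) w x y = gp (dist π) 1 (w⁻¹ * x) (w⁻¹ * y) := by
  rw [← gp_mul_left hπ w⁻¹, inv_mul_cancel]

theorem isEdgePath_word (hπ : Function.Surjective π) (x : G) (w : List A) :
    IsEdgePath (dist π) x (x * val π w) w.length fun n => x * val π (w.take n) where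
  zero := by simp [val_nil]
  last i hi := by rw [List.take_of_length_le hi]
  step i := by
    rw [dist_mul_left hπ]
    rcases lt_or_ge i w.length with hi | hi
    · have hval : val π (w.take (i + 1)) = val π (w.take i) * π (FreeMonoid.of w[i]) := by
        rw [List.take_succ_eq_append_getElem hi, val_append, val_cons, val_nil, mul_one]
      rw [hval]
      set g := val π (w.take i)
      set s := π (FreeMonoid.of w[i]) with hs
      -- A letter may represent the identity, and then the path does not move.
      by_cases h : g = g * s
      · rw [← h, (isGraphMetric_dist hπ).self]
        omega
      · refine (SimpleGraph.dist_eq_one_iff_adj.2 ((SimpleGraph.mulCayley_adj _ _ _).2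
          ⟨h, Or.inl ?_⟩)).le
        rw [inv_mul_cancel_left]
        exact ⟨_, rfl⟩
    · rw [List.take_of_length_le hi, List.take_of_length_le (by omega),
        (isGraphMetric_dist hπ).self]
      omega

theorem length_eq_of_mem_geo (hπ : Function.Surjective π) {w : List A} (hw : w ∈ Geo π)
    (x : G) : w.length = dist π x (x * val π w) := by
  have h : w.length = dist π 1 (val π w) := hw
  rw [h, ← dist_mul_left hπ x, mul_one]

theorem isEdgePath_geo (hπ : Function.Surjective π) {w : List A} (hw : w ∈ Geo π) {x y : G}
    (hy : x * val π w = y) :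
    IsEdgePath (dist π) x y (dist π x y) fun n => x * val π (w.take n) := by
  have := isEdgePath_word hπ x w
  subst hy
  rwa [length_eq_of_mem_geo hπ hw x] at this

theorem exists_geo (hπ : Function.Surjective π)
    (hinv : ∀ a : A, ∃ b : A, π (FreeMonoid.of b) = (π (FreeMonoid.of a))⁻¹) (x y : G) :
    ∃ w ∈ Geo π, x * val π w = y := by
  have h := isGraphMetric_dist hπ
  suffices ∀ n x y, dist π x y = n → ∃ w : List A, w.length = n ∧ x * val π w = y by
    obtain ⟨w, h1, h2⟩ := this _ x y rfl
    refine ⟨w, ?_, h2⟩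
    change w.length = dist π 1 (val π w)
    rw [h1, ← h2, ← dist_mul_left hπ x 1, mul_one]
  intro n
  induction n with
  | zero =>
    intro x y hxy
    exact ⟨[], rfl, by simp [val_nil, h.eq_of_zero hxy]⟩
  | succ n ih =>
    intro x y hxy
    obtain ⟨m, h1, h2⟩ := h.between x y 1 (by omega)
    obtain ⟨w, h3, h4⟩ := ih m y (by omega)
    obtain ⟨a, ha⟩ : ∃ a, x * π (FreeMonoid.of a) = m := by
      rcases ((SimpleGraph.mulCayley_adj _ _ _).1 (SimpleGraph.dist_eq_one_iff_adj.1 h1)).2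
        with ⟨a, ha⟩ | ⟨a, ha⟩
      · exact ⟨a, by simp only at ha; rw [ha]; group⟩
      -- The edge is traversed against its generator, so an inverse letter is needed.
      · obtain ⟨b, hb⟩ := hinv a
        exact ⟨b, by simp only at ha; rw [hb, ha]; group⟩
    exact ⟨a :: w, by simp [h3], by rw [val_cons, ← mul_assoc, ha, h4]⟩

/-- Hyperbolicity of a group does not depend on the finite generating set. -/
theorem IsHyperbolicGroup.exists_fourPoint (hG : IsHyperbolicGroup G) [Finite A]
    (hπ : Function.Surjective π) : ∃ δ, FourPoint (dist π) δ := by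
  obtain ⟨S, hfin, hS, δ, hδ⟩ := hG
  have hfin' : (gens π).Finite := Set.finite_range _
  obtain ⟨L₁, hL₁⟩ := exists_lipschitz hfin hS (closure_gens hπ) (MonoidHom.id G)
  obtain ⟨L₂, hL₂⟩ := exists_lipschitz hfin' (closure_gens hπ) hS (MonoidHom.id G)
  refine FourPoint.of_bilipschitz (δ := δ) (L := max L₁ L₂) (isGraphMetric_cayleyDist hS)
    (isGraphMetric_dist hπ) hδ (fun x y => ?_) fun x y => ?_
  · exact (hL₂ x y).trans (Nat.mul_le_mul_right _ (le_max_right _ _))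
  · exact (hL₁ x y).trans (Nat.mul_le_mul_right _ (le_max_left _ _))

end

end BRP

/-! ### Gromov products of concatenations and distances to geodesics. -/

namespace BRP

section

variable {G : Type*} [Group G] {A : Type*} {π : FreeMonoid A →* G} {φ : G →* G}

theorem gp_inv_left (hπ : Function.Surjective π) {u v : List A} :
    gp (dist π) 1 (val π u)⁻¹ (val π v) = gp (dist π) (val π u) 1 (val π (u ++ v)) := by
  rw [gp_eq_one hπ (val π u), val_append, mul_one, inv_mul_cancel_left]

theorem gp_inv_left_eq (hπ : Function.Surjective π) {u v : List A} (hu : u ∈ Geo π)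
    (hv : v ∈ Geo π) :
    gp (dist π) 1 (val π u)⁻¹ (val π v) =
      ((u.length : ℝ) + v.length - dist π 1 (val π (u ++ v))) / 2 := by
  have h := isGraphMetric_dist hπ
  have h1 := length_eq_of_mem_geo hπ hu 1
  have h2 := length_eq_of_mem_geo hπ hv (val π u)
  rw [one_mul, h.symm] at h1
  rw [← val_append] at h2
  rw [gp_inv_left hπ, gp, h1, h2]

theorem gp_le_of_isQuasiGeodesic (hπ : Function.Surjective π) {u v : List A} {q : ℝ}
    (hu : u ∈ Geo π) (hv : v ∈ Geo π) (hq : IsQuasiGeodesic π 1 q (u ++ v)) :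
    gp (dist π) 1 (val π u)⁻¹ (val π v) ≤ q / 2 := by
  rw [gp_inv_left_eq hπ hu hv]
  have h1 := (hq 0 (u ++ v).length (Nat.zero_le _) le_rfl).1
  rw [List.take_length, List.take_zero, val_nil] at h1
  simp only [Nat.cast_zero, zero_sub, abs_neg, Nat.abs_cast, div_one, one_mul] at h1
  rw [List.length_append, Nat.cast_add] at h1
  linarith

/-- The whole path falls short of its length by at most `2 * q`, and no subpath can lose more than
the whole. -/
theorem isQuasiGeodesic_of_gp_le (hπ : Function.Surjective π) {u v : List A} {q : ℝ}
    (hu : u ∈ Geo π) (hv : v ∈ Geo π) (hq : gp (dist π) 1 (val π u)⁻¹ (val π v) ≤ q) :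
    IsQuasiGeodesic π 1 (2 * q) (u ++ v) := by
  have h := isGraphMetric_dist hπ
  have hq0 : 0 ≤ q := (h.gp_nonneg _ _ _).trans hq
  rw [gp_inv_left_eq hπ hu hv] at hq
  have hlen : (((u ++ v).length : ℕ) : ℝ) = u.length + v.length := by simp
  set w := u ++ v with hw
  have hp := isEdgePath_word hπ 1 w
  simp only [one_mul] at hp
  have key : ∀ i j, i ≤ j → j ≤ w.length →
      (j : ℝ) - i - 2 * q ≤ dist π (val π (w.take i)) (val π (w.take j)) ∧
      (dist π (val π (w.take i)) (val π (w.take j)) : ℝ) ≤ j - i := by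
    intro i j hij hj
    have h1 := hp.dist_le h 0 i
    have h2 := hp.dist_le h i (j - i)
    have h3 := hp.dist_le h j (w.length - j)
    simp only [zero_add, List.take_zero, val_nil] at h1
    rw [show i + (j - i) = j by omega] at h2
    rw [show j + (w.length - j) = w.length by omega, List.take_length] at h3
    have h1' : (dist π 1 (val π (w.take i)) : ℝ) ≤ i := by exact_mod_cast h1
    have h2' : (dist π (val π (w.take i)) (val π (w.take j)) : ℝ) ≤ (j - i : ℕ) := by
      exact_mod_cast h2
    have h3' : (dist π (val π (w.take j)) (val π w) : ℝ) ≤ (w.length - j : ℕ) := by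
      exact_mod_cast h3
    rw [Nat.cast_sub hij] at h2'
    rw [Nat.cast_sub hj] at h3'
    have t1 := h.triR 1 (val π (w.take i)) (val π w)
    have t2 := h.triR (val π (w.take i)) (val π (w.take j)) (val π w)
    constructor <;> linarith
  intro i j hi hj
  rcases le_total i j with hij | hij
  · have hij' : (i : ℝ) ≤ j := by exact_mod_cast hij
    rw [abs_sub_comm, abs_of_nonneg (sub_nonneg.2 hij')]
    obtain ⟨h1, h2⟩ := key i j hij hj
    constructor <;> linarith
  · have hij' : (j : ℝ) ≤ i := by exact_mod_cast hij
    rw [abs_of_nonneg (sub_nonneg.2 hij'), h.symmR]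
    obtain ⟨h1, h2⟩ := key j i hij hi
    constructor <;> linarith

/-- The corner of the path `u₁u₂` is within `p` of a vertex of the geodesic `u₃`. -/
theorem gp_le_of_mft (hπ : Function.Surjective π) {u₁ u₂ u₃ : List A} {p : ℝ}
    (h₃ : u₃ ∈ Geo π) (hp : MFT π p (u₁ ++ u₂) u₃) :
    gp (dist π) 1 (val π u₁)⁻¹ (val π u₂) ≤ p := by
  have h := isGraphMetric_dist hπ
  obtain ⟨h1, h2⟩ := hp
  have h3 := h2 u₁.length
  rw [List.take_left] at h3
  rw [gp_inv_left hπ, h1]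
  have h4 := (isEdgePath_geo hπ h₃ (one_mul _)).between h u₁.length
  simp only [one_mul] at h4
  exact (gp_le_of_between h h4 _).trans h3

/-- Prefixes of both paths have large product with the common endpoint, hence with each other. In `6
* q`, a share `4 * q` comes from the products and `2 * q` from the excess length of `u₁u₂`. -/
theorem mft_of_gp_le (hπ : Function.Surjective π) {δ : ℝ} (hδ : FourPoint (dist π) δ)
    {u₁ u₂ u₃ : List A} {q : ℝ} (h₁ : u₁ ∈ Geo π) (h₂ : u₂ ∈ Geo π) (h₃ : u₃ ∈ Geo π)
    (h₁₂ : val π u₁ * val π u₂ = val π u₃)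
    (hq : gp (dist π) 1 (val π u₁)⁻¹ (val π u₂) ≤ q) :
    MFT π (6 * q + 2 * δ) (u₁ ++ u₂) u₃ := by
  have h := isGraphMetric_dist hπ
  have hq0 : 0 ≤ q := (h.gp_nonneg _ _ _).trans hq
  refine ⟨by rw [val_append, h₁₂], fun n => ?_⟩
  rw [gp_inv_left_eq hπ h₁ h₂] at hq
  have hlen : (((u₁ ++ u₂).length : ℕ) : ℝ) = u₁.length + u₂.length := by simp
  have hval : val π (u₁ ++ u₂) = val π u₃ := by rw [val_append, h₁₂]
  set w := u₁ ++ u₂ with hw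
  have hp := isEdgePath_word hπ 1 w
  have hp' := isEdgePath_geo hπ h₃ (one_mul _)
  have hl : u₃.length = dist π 1 (val π u₃) := h₃
  have hlw := hp.dist_le h 0 w.length
  simp only [one_mul] at hp hp'
  simp only [zero_add, List.take_zero, val_nil, one_mul, List.take_length, hval] at hlw
  rw [hval] at hq
  have a1 := hp.dist_le h 0 (min n w.length)
  have a2 := hp.dist_le h (min n w.length) (w.length - min n w.length)
  rw [show min n w.length + (w.length - min n w.length) = w.length by omega] at a2
  have b1 := hp'.dist_eq h (Nat.zero_le (min n u₃.length)) (by omega)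
  have b2 := hp'.between h (min n u₃.length)
  have e1 : w.take (min n w.length) = w.take n := by
    rw [List.take_eq_take_iff]
    simp
  have e2 : u₃.take (min n u₃.length) = u₃.take n := by
    rw [List.take_eq_take_iff]
    simp
  simp only [zero_add, List.take_zero, val_nil, List.take_length, hval, e1, e2] at a1 a2 b1 b2
  set a := val π (w.take n)
  set b := val π (u₃.take n)
  set e := val π u₃
  set i := min n w.length with hi
  set j := min n u₃.length with hj
  have hij : j ≤ i := by omega
  have hil : i ≤ w.length := by omega
  have hij' : i ≤ j + (w.length - u₃.length) := by omega
  have a1' : (dist π 1 a : ℝ) ≤ i := by exact_mod_cast a1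
  have a2' : (dist π a e : ℝ) ≤ w.length - i := by
    rw [← Nat.cast_sub hil]
    exact_mod_cast a2
  have b1' : (dist π 1 b : ℝ) = j := by exact_mod_cast b1
  have b2' : (dist π 1 b : ℝ) + dist π b e = dist π 1 e := by exact_mod_cast b2
  have hij'' : (i : ℝ) ≤ j + (w.length - dist π 1 e) := by
    rw [← Nat.cast_sub (by omega)]
    rw [hl] at hij'
    exact_mod_cast hij'
  have hijR : (j : ℝ) ≤ i := by exact_mod_cast hij
  have t1 := h.triR 1 a e
  have t2 := h.symmR e b
  have g1 : (j : ℝ) - 2 * q ≤ gp (dist π) 1 a e := by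
    unfold gp
    linarith
  have g2 : (j : ℝ) - 2 * q ≤ gp (dist π) 1 e b := by
    unfold gp
    linarith
  have g3 := hδ 1 a e b
  have g4 := le_min g1 g2
  have g5 : (j : ℝ) - 2 * q - δ ≤ gp (dist π) 1 a b := by linarith
  unfold gp at g5
  linarith

/-- A point with small Gromov product is close to every geodesic. -/
theorem mem_nbhd_of_gp_le (hπ : Function.Surjective π) {δ : ℝ} (hδ : FourPoint (dist π) δ)
    {x y a : G} {c : ℝ} (hc : gp (dist π) a x y ≤ c) {w : List A} (hw : w ∈ Geo π)
    (hy : x * val π w = y) : a ∈ nbhd π ⌈c + 1 + 2 * δ⌉₊ (pathSet π x w) := by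
  have h := isGraphMetric_dist hπ
  obtain ⟨t, ht, H⟩ := hδ.exists_projection h x y a
  have hp := isEdgePath_geo hπ hw hy
  have h1 := hp.dist_eq h (Nat.zero_le t) ht
  have h2 := hp.between h t
  simp only [List.take_zero, val_nil, mul_one, Nat.sub_zero] at h1
  obtain ⟨h3, -, -⟩ := H (x * val π (w.take t)) h1 (by omega)
  refine ⟨_, ⟨t, rfl⟩, ?_⟩
  have h4 : (dist π a (x * val π (w.take t)) : ℝ) ≤ ⌈c + 1 + 2 * δ⌉₊ :=
    le_trans (by linarith) (Nat.le_ceil _)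
  exact_mod_cast h4

theorem gp_le_of_mem_nbhd (hπ : Function.Surjective π) {x y a : G} {N : ℕ} {w : List A}
    (hw : w ∈ Geo π) (hy : x * val π w = y) (ha : a ∈ nbhd π N (pathSet π x w)) :
    gp (dist π) a x y ≤ N := by
  have h := isGraphMetric_dist hπ
  obtain ⟨_, ⟨t, rfl⟩, ht⟩ := ha
  refine (gp_le_of_between h ((isEdgePath_geo hπ hw hy).between h t) a).trans ?_
  exact_mod_cast ht

theorem map_endpoint {x y : G} {α ξ : List A} (hy : x * val π α = y)
    (hξ : val π ξ = φ (val π α)) : φ x * val π ξ = φ y := by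
  rw [hξ, ← map_mul, hy]

/-- Two coarse medians of the same triple are close. -/
theorem FourPoint.dist_median_le {X : Type*} {d : X → X → ℕ} {δ : ℝ} (hδ : FourPoint d δ)
    (h : IsGraphMetric d) {x y z m m' : X} {c : ℝ} (h1 : gp d m x y ≤ c) (h2 : gp d m x z ≤ c)
    (h3 : gp d m y z ≤ c) (h1' : gp d m' x y ≤ c) (h2' : gp d m' x z ≤ c)
    (h3' : gp d m' y z ≤ c) : (d m m' : ℝ) ≤ 2 * (c + δ) := by
  have key : ∀ {m x y : X} (m' : X), gp d m x y ≤ c →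
      gp d m x m' ≤ c + δ ∨ gp d m y m' ≤ c + δ := by
    intro m x y m' hm
    have := hδ m x m' y
    rw [h.gp_symm m m' y] at this
    rcases min_le_iff.1 (show min (gp d m x m') (gp d m y m') ≤ c + δ by linarith) with h | h
    · exact Or.inl h
    · exact Or.inr h
  have fin : ∀ {x : X}, gp d m x m' ≤ c + δ → gp d m' x m ≤ c + δ →
      (d m m' : ℝ) ≤ 2 * (c + δ) := by
    intro x ha hb
    have := h.symmR x m
    have := h.symmR x m'
    have := h.symmR m m'
    unfold gp at ha hb
    linarith
  -- The choices for `m` name at least two of `x, y, z`, as do those for `m'`, so some point is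
  -- named by both.
  rcases key m' h1 with a | a <;> rcases key m' h2 with b | b <;> rcases key m' h3 with c | c <;>
  rcases key m h1' with a' | a' <;> rcases key m h2' with b' | b' <;>
  rcases key m h3' with c' | c' <;>
  first
    | exact fin a a'
    | exact fin a b'
    | exact fin a c'
    | exact fin b a'
    | exact fin b b'
    | exact fin b c'
    | exact fin c a'
    | exact fin c b'

/-- A discrete intermediate value theorem for upward jumps of at most `K`. -/
theorem exists_crossing {f : ℕ → ℕ} {K s : ℕ} (h0 : f 0 = 0) (hK : ∀ i, f (i + 1) ≤ f i + K)
    (n : ℕ) (hn : s ≤ f n) : ∃ i, f i ≤ s ∧ s ≤ f i + K := by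
  induction n with
  | zero => exact ⟨0, by omega, by omega⟩
  | succ n ih =>
    rcases le_or_gt s (f n) with h | h
    · exact ih h
    · exact ⟨n, h.le, hn.trans (hK n)⟩

/-! ### Equivalence of the formulations. -/

/-- Bounded Gromov products have bounded images, for all bounds and base points. -/
def ImageGPBounded (π : FreeMonoid A →* G) (φ : G →* G) : Prop :=
  ∀ p : ℝ, ∃ q : ℝ, ∀ w u v : G, gp (dist π) w u v ≤ p → gp (dist π) (φ w) (φ u) (φ v) ≤ q

/-- Left translation moves the base point to `1`, and `φ` respects translations. -/
theorem hypBRPGromov_iff (hπ : Function.Surjective π) :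
    HypBRPGromov π φ ↔ ImageGPBounded π φ := by
  constructor
  · intro H p
    obtain ⟨q, -, hq⟩ := H (max p 1) (by positivity)
    refine ⟨q, fun w u v hp => ?_⟩
    rw [gp_eq_one hπ] at hp ⊢
    simp only [← map_inv, ← map_mul]
    exact hq _ _ (hp.trans (le_max_left _ _))
  · intro H p _
    obtain ⟨q, hq⟩ := H p
    refine ⟨max q 1, by positivity, fun u v hp => (le_max_left q 1).trans' ?_⟩
    have := hq 1 u v hp
    rwa [map_one] at this

theorem ImageGPBounded.at_one (H : ImageGPBounded π φ) (p : ℝ) :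
    ∃ q : ℝ, 0 ≤ q ∧ ∀ u v : G, gp (dist π) 1 u v ≤ p → gp (dist π) 1 (φ u) (φ v) ≤ q := by
  obtain ⟨q, hq⟩ := H p
  refine ⟨max q 0, le_max_right _ _, fun u v hp => (le_max_left q 0).trans' ?_⟩
  have := hq 1 u v hp
  rwa [map_one] at this

theorem ImageGPBounded.hypBRPGromovZero (H : ImageGPBounded π φ) : HypBRPGromovZero π φ := by
  obtain ⟨q, hq0, hq⟩ := H.at_one 0
  exact ⟨q + 1, by linarith, fun u v h0 => (hq u v (le_of_eq h0)).trans (by linarith)⟩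

theorem HypBRPGromovZero.hypBRPNbhd (hπ : Function.Surjective π) {δ : ℝ}
    (hδ : FourPoint (dist π) δ) (H : HypBRPGromovZero π φ) : HypBRPNbhd π φ := by
  have h := isGraphMetric_dist hπ
  obtain ⟨q, -, hq⟩ := H
  refine ⟨⌈q + 1 + 2 * δ⌉₊, fun x α hα ξ hξ hval => ?_⟩
  rintro _ ⟨_, ⟨n, rfl⟩, rfl⟩
  refine mem_nbhd_of_gp_le hπ hδ ?_ hξ (map_endpoint rfl hval)
  have hb := (isEdgePath_geo hπ hα (rfl : x * val π α = _)).between h n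
  set a := x * val π (α.take n)
  set y := x * val π α
  have h1 : gp (dist π) a x y = 0 := by
    refine le_antisymm ((gp_le_of_between h hb a).trans (by simp [h.self])) (h.gp_nonneg _ _ _)
  rw [gp_eq_one hπ] at h1 ⊢
  simp only [← map_inv, ← map_mul]
  exact hq _ _ h1

/-- `w` is near some `z` on `[x,y]`, and `φ z` is near `[φ x, φ y]`; moving the base point from `φ
z` to `φ w` costs at most their distance. -/
theorem HypBRPNbhd.imageGPBounded (hπ : Function.Surjective π)
    (hinv : ∀ a : A, ∃ b : A, π (FreeMonoid.of b) = (π (FreeMonoid.of a))⁻¹) {δ : ℝ}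
    (hδ : FourPoint (dist π) δ) {K : ℕ} (hK : ∀ x y, dist π (φ x) (φ y) ≤ K * dist π x y)
    (H : HypBRPNbhd π φ) : ImageGPBounded π φ := by
  have h := isGraphMetric_dist hπ
  obtain ⟨N, hN⟩ := H
  intro p
  refine ⟨(N : ℝ) + K * ⌈p + 1 + 2 * δ⌉₊, fun w x y hp => ?_⟩
  obtain ⟨α, hα, hy⟩ := exists_geo hπ hinv x y
  obtain ⟨ξ, hξ, hval⟩ := exists_geo hπ hinv 1 (φ (val π α))
  rw [one_mul] at hval
  obtain ⟨z, hz, hwz⟩ := mem_nbhd_of_gp_le hπ hδ hp hα hy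
  have h1 := gp_le_of_mem_nbhd hπ hξ (map_endpoint hy hval) (hN x α hα ξ hξ hval ⟨z, hz, rfl⟩)
  have h2 : (dist π (φ w) (φ z) : ℝ) ≤ K * ⌈p + 1 + 2 * δ⌉₊ := by
    exact_mod_cast (hK w z).trans (Nat.mul_le_mul_left K hwz)
  have := h.triR (φ w) (φ z) (φ x)
  have := h.triR (φ w) (φ z) (φ y)
  have := h.triR (φ z) (φ w) (φ x)
  unfold gp at *
  linarith

theorem HypBRPNbhd.hypBRPHausdorff (hπ : Function.Surjective π) {K : ℕ}
    (hK : ∀ x y, dist π (φ x) (φ y) ≤ K * dist π x y) (H : HypBRPNbhd π φ) :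
    HypBRPHausdorff π φ := by
  have h := isGraphMetric_dist hπ
  obtain ⟨N, hN⟩ := H
  refine ⟨2 * N + K, fun x α hα ξ hξ hval => ⟨fun a ha => ?_, ?_⟩⟩
  · obtain ⟨z, hz, hz'⟩ := hN x α hα ξ hξ hval ha
    exact ⟨z, hz, by omega⟩
  rintro _ ⟨s₀, rfl⟩
  have hp := isEdgePath_geo hπ hα (rfl : x * val π α = _)
  have hq := isEdgePath_geo hπ hξ (map_endpoint (φ := φ) (rfl : x * val π α = _) hval)
  set y := x * val π α
  obtain ⟨s, hs, hs'⟩ : ∃ s, s ≤ dist π (φ x) (φ y) ∧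
      φ x * val π (ξ.take s₀) = φ x * val π (ξ.take s) := by
    rcases le_total s₀ (dist π (φ x) (φ y)) with hle | hle
    · exact ⟨s₀, hle, rfl⟩
    · exact ⟨_, le_rfl, (hq.last _ hle).trans (hq.last _ le_rfl).symm⟩
  -- Find an image point whose distance from `φ x` is `s` up to `K`. It is `N`-close to the vertex
  -- of `ξ` at some position `t`, so `s` and `t` differ by at most `N + K`.
  obtain ⟨i, hi1, hi2⟩ := exists_crossing (K := K) (s := s)
    (f := fun i => dist π (φ x) (φ (x * val π (α.take i))))
    (by simp [val_nil, h.self])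
    (fun i => by
      have h1 := hK (x * val π (α.take i)) (x * val π (α.take (i + 1)))
      have h2 := Nat.mul_le_mul_left K (hp.step i)
      have h3 := h.tri (φ x) (φ (x * val π (α.take i))) (φ (x * val π (α.take (i + 1))))
      omega)
    (dist π x y) (by
      have := hp.last _ le_rfl
      rwa [this])
  obtain ⟨_, ⟨t₀, rfl⟩, ht⟩ := hN x α hα ξ hξ hval ⟨_, ⟨i, rfl⟩, rfl⟩
  obtain ⟨t, htl, ht'⟩ : ∃ t, t ≤ dist π (φ x) (φ y) ∧
      φ x * val π (ξ.take t₀) = φ x * val π (ξ.take t) := by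
    rcases le_total t₀ (dist π (φ x) (φ y)) with hle | hle
    · exact ⟨t₀, hle, rfl⟩
    · exact ⟨_, le_rfl, (hq.last _ hle).trans (hq.last _ le_rfl).symm⟩
  refine ⟨_, ⟨_, ⟨i, rfl⟩, rfl⟩, ?_⟩
  simp only at hi1 hi2 ht ⊢
  rw [ht'] at ht
  rw [hs']
  have e1 := hq.dist_eq h (Nat.zero_le t) htl
  simp only [List.take_zero, val_nil, mul_one] at e1
  have e2 : dist π (φ x * val π (ξ.take s)) (φ x * val π (ξ.take t)) ≤ N + K := by
    have u1 := h.tri (φ x) (φ (x * val π (α.take i))) (φ x * val π (ξ.take t))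
    have u2 := h.tri (φ x) (φ x * val π (ξ.take t)) (φ (x * val π (α.take i)))
    have u3 := h.symm (φ x * val π (ξ.take t)) (φ (x * val π (α.take i)))
    rcases le_total s t with hst | hst
    · have := hq.dist_eq h hst htl
      omega
    · have := hq.dist_eq h hst hs
      have u4 := h.symm (φ x * val π (ξ.take t)) (φ x * val π (ξ.take s))
      omega
  have u5 := h.tri (φ x * val π (ξ.take s)) (φ x * val π (ξ.take t)) (φ (x * val π (α.take i)))
  have u6 := h.symm (φ x * val π (ξ.take t)) (φ (x * val π (α.take i)))
  omega

theorem HypBRPHausdorff.hypBRPNbhd (H : HypBRPHausdorff π φ) : HypBRPNbhd π φ := by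
  obtain ⟨N, hN⟩ := H
  exact ⟨N, fun x α hα ξ hξ hval => (hN x α hα ξ hξ hval).1⟩

theorem ImageGPBounded.coarseMedianPreserving (hπ : Function.Surjective π) {δ : ℝ}
    (hδ : FourPoint (dist π) δ) (H : ImageGPBounded π φ) : CoarseMedianPreserving π φ := by
  have h := isGraphMetric_dist hπ
  choose μ h1 h2 h3 using fun x y z => hδ.exists_median h x y z
  refine ⟨μ, ⟨⌈δ + 1 + 1 + 2 * δ⌉₊, fun x y z w hw => ⟨?_, ?_, ?_⟩⟩, ?_⟩
  · exact fun hy => mem_nbhd_of_gp_le hπ hδ (h1 x y z) hw hy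
  · exact fun hy => mem_nbhd_of_gp_le hπ hδ (h3 x y z) hw hy
  · exact fun hy => mem_nbhd_of_gp_le hπ hδ ((h.gp_symm _ z x).trans_le (h2 x y z)) hw hy
  · obtain ⟨q, hq⟩ := H (δ + 1)
    refine ⟨⌈2 * (max q (δ + 1) + δ)⌉₊, fun x y z => ?_⟩
    have := hδ.dist_median_le h (c := max q (δ + 1))
      ((hq _ _ _ (h1 x y z)).trans (le_max_left _ _))
      ((hq _ _ _ (h2 x y z)).trans (le_max_left _ _))
      ((hq _ _ _ (h3 x y z)).trans (le_max_left _ _))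
      ((h1 (φ x) (φ y) (φ z)).trans (le_max_right _ _))
      ((h2 (φ x) (φ y) (φ z)).trans (le_max_right _ _))
      ((h3 (φ x) (φ y) (φ z)).trans (le_max_right _ _))
    exact_mod_cast this.trans (Nat.le_ceil _)

theorem CoarseMedianPreserving.hypBRPNbhd (hπ : Function.Surjective π)
    (hinv : ∀ a : A, ∃ b : A, π (FreeMonoid.of b) = (π (FreeMonoid.of a))⁻¹) {K : ℕ}
    (hK : ∀ x y, dist π (φ x) (φ y) ≤ K * dist π x y) (H : CoarseMedianPreserving π φ) :
    HypBRPNbhd π φ := by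
  have h := isGraphMetric_dist hπ
  obtain ⟨μ, ⟨c, hc⟩, C, hC⟩ := H
  refine ⟨K * (3 * c) + C + c, fun x α hα ξ hξ hval => ?_⟩
  rintro _ ⟨_, ⟨n, rfl⟩, rfl⟩
  have hb := (isEdgePath_geo hπ hα (rfl : x * val π α = _)).between h n
  simp only at hb ⊢
  have hend := map_endpoint (φ := φ) (rfl : x * val π α = _) hval
  set a := x * val π (α.take n)
  set y := x * val π α
  obtain ⟨w, hw, hwa⟩ := exists_geo hπ hinv y a
  obtain ⟨w', hw', hwa'⟩ := exists_geo hπ hinv a x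
  obtain ⟨_, ⟨i, rfl⟩, hi⟩ := (hc x y a w hw).2.1 hwa
  obtain ⟨_, ⟨j, rfl⟩, hj⟩ := (hc x y a w' hw').2.2 hwa'
  obtain ⟨z, hz, hz'⟩ := (hc (φ x) (φ y) (φ a) ξ hξ).1 hend
  have b1 := (isEdgePath_geo hπ hw hwa).between h i
  have b2 := (isEdgePath_geo hπ hw' hwa').between h j
  set s := y * val π (w.take i)
  set t := a * val π (w'.take j)
  change dist π (μ x y a) s ≤ c at hi
  change dist π (μ x y a) t ≤ c at hj
  -- The median is `c`-close to `s` on `[y,a]` and to `t` on `[a,x]`. As `a` lies between `x` and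
  -- `y`, the sum of its distances to `s` and `t` is at most `2 * c`.
  have hμ : dist π a (μ x y a) ≤ 3 * c := by
    have := h.tri x t y
    have := h.tri t s y
    have := h.tri t (μ x y a) s
    have := h.tri a t (μ x y a)
    have := h.symm t (μ x y a)
    have := h.symm t x
    have := h.symm a x
    have := h.symm y s
    have := h.symm y a
    omega
  refine ⟨z, hz, ?_⟩
  have k1 := (hK a (μ x y a)).trans (Nat.mul_le_mul_left K hμ)
  have k2 := hC x y a
  have := h.tri (φ a) (φ (μ x y a)) z
  have := h.tri (φ (μ x y a)) (μ (φ x) (φ y) (φ a)) z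
  omega

theorem ImageGPBounded.hypBRPQuasi (hπ : Function.Surjective π) (H : ImageGPBounded π φ) :
    HypBRPQuasi π φ := by
  intro p _
  obtain ⟨q, hq0, hq⟩ := H.at_one (p / 2)
  refine ⟨2 * q, by linarith, fun u hu v hv huv α hα β hβ hα' hβ' => ?_⟩
  refine isQuasiGeodesic_of_gp_le hπ hα hβ ?_
  rw [hα', hβ', ← map_inv]
  exact hq _ _ (gp_le_of_isQuasiGeodesic hπ hu hv huv)

theorem HypBRPQuasi.hypBRPGeo (hπ : Function.Surjective π) (H : HypBRPQuasi π φ) :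
    HypBRPGeo π φ := by
  obtain ⟨q, hq0, hq⟩ := H 0 le_rfl
  refine ⟨q, hq0, fun u hu v hv huv => hq u hu v hv ?_⟩
  have hlen : (u ++ v).length = dist π 1 (val π (u ++ v)) := huv
  rw [← mul_zero 2]
  refine isQuasiGeodesic_of_gp_le hπ hu hv ?_
  rw [gp_inv_left_eq hπ hu hv, ← hlen]
  simp

theorem HypBRPGeo.hypBRPGromovZero (hπ : Function.Surjective π)
    (hinv : ∀ a : A, ∃ b : A, π (FreeMonoid.of b) = (π (FreeMonoid.of a))⁻¹)
    (H : HypBRPGeo π φ) : HypBRPGromovZero π φ := by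
  obtain ⟨q, hq0, hq⟩ := H
  refine ⟨q / 2 + 1, by linarith, fun x y hxy => ?_⟩
  have word : ∀ g : G, ∃ w ∈ Geo π, val π w = g := by
    intro g
    simpa using exists_geo hπ hinv 1 g
  obtain ⟨u, hu, hu'⟩ := word x⁻¹
  obtain ⟨v, hv, rfl⟩ := word y
  obtain ⟨α, hα, hα'⟩ := word (φ (val π u))
  obtain ⟨β, hβ, hβ'⟩ := word (φ (val π v))
  obtain rfl : x = (val π u)⁻¹ := by rw [hu', inv_inv]
  have huv : u ++ v ∈ Geo π := by
    have h1 : gp (dist π) 1 (val π u)⁻¹ (val π v) = 0 := hxy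
    rw [gp_inv_left_eq hπ hu hv] at h1
    have h2 : (u.length : ℝ) + v.length = dist π 1 (val π (u ++ v)) := by linarith
    change (u ++ v).length = _
    rw [List.length_append]
    exact_mod_cast h2
  have h3 := gp_le_of_isQuasiGeodesic hπ hα hβ (hq u hu v hv huv α hα β hβ hα' hβ')
  rw [hα', hβ', ← map_inv] at h3
  exact h3.trans (by linarith)

theorem ImageGPBounded.ftbrp (hπ : Function.Surjective π) {δ : ℝ}
    (hδ : FourPoint (dist π) δ) (H : ImageGPBounded π φ) :
    FTBRP π π φ (Geo π) (Geo π) := by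
  have hδ0 := (isGraphMetric_dist hπ).nonneg_of_fourPoint hδ 1
  intro p _
  obtain ⟨q, hq0, hq⟩ := H.at_one p
  refine ⟨6 * q + 2 * δ, by linarith, fun u₁ _ u₂ _ u₃ hu₃ v₁ hv₁ v₂ hv₂ v₃ hv₃ e₁ e₂ e₃ hm => ?_⟩
  refine mft_of_gp_le hπ hδ hv₁ hv₂ hv₃ ?_ ?_
  · rw [e₁, e₂, e₃, ← hm.1, val_append, map_mul]
  · rw [e₁, e₂, ← map_inv]
    exact hq _ _ (gp_le_of_mft hπ hu₃ hm)

theorem imageGPBounded_of_ftbrp (hπ : Function.Surjective π)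
    (hinv : ∀ a : A, ∃ b : A, π (FreeMonoid.of b) = (π (FreeMonoid.of a))⁻¹) {δ : ℝ}
    (hδ : FourPoint (dist π) δ) (H : FTBRP π π φ (Geo π) (Geo π)) : ImageGPBounded π φ := by
  have h := isGraphMetric_dist hπ
  have hδ0 := h.nonneg_of_fourPoint hδ 1
  have word : ∀ g : G, ∃ w ∈ Geo π, val π w = g := by
    intro g
    simpa using exists_geo hπ hinv 1 g
  rw [← hypBRPGromov_iff hπ]
  intro p hp
  obtain ⟨q, hq0, hq⟩ := H (6 * p + 2 * δ) (by linarith)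
  refine ⟨q + 1, by linarith, fun x y hxy => ?_⟩
  obtain ⟨u₁, hu₁, hu₁'⟩ := word x⁻¹
  obtain ⟨u₂, hu₂, rfl⟩ := word y
  obtain rfl : x = (val π u₁)⁻¹ := by rw [hu₁', inv_inv]
  obtain ⟨u₃, hu₃, hu₃'⟩ := word (val π u₁ * val π u₂)
  obtain ⟨v₁, hv₁, e₁⟩ := word (φ (val π u₁))
  obtain ⟨v₂, hv₂, e₂⟩ := word (φ (val π u₂))
  obtain ⟨v₃, hv₃, e₃⟩ := word (φ (val π u₃))
  have hm := hq u₁ hu₁ u₂ hu₂ u₃ hu₃ v₁ hv₁ v₂ hv₂ v₃ hv₃ e₁ e₂ e₃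
    (mft_of_gp_le hπ hδ hu₁ hu₂ hu₃ hu₃'.symm hxy)
  have h1 := gp_le_of_mft hπ hv₃ hm
  rw [e₁, e₂, ← map_inv] at h1
  exact h1.trans (by linarith)

end

end BRP

theorem corollary3p9 {G : Type*} [Group G] (hG : BRP.IsHyperbolicGroup G)
    {A : Type*} [Finite A] (π : FreeMonoid A →* G) (hπ : Function.Surjective π)
    (hinv : ∀ a : A, ∃ b : A, π (FreeMonoid.of b) = (π (FreeMonoid.of a))⁻¹)
    (φ : G →* G) :
    List.TFAE
      [BRP.FTBRP π π φ (BRP.Geo π) (BRP.Geo π),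
        BRP.HypBRPQuasi π φ,
        BRP.HypBRPGeo π φ,
        BRP.HypBRPGromov π φ,
        BRP.HypBRPGromovZero π φ,
        BRP.HypBRPHausdorff π φ,
        BRP.HypBRPNbhd π φ,
        BRP.CoarseMedianPreserving π φ] := by
  obtain ⟨δ, hδ⟩ := hG.exists_fourPoint hπ
  obtain ⟨K, hK⟩ : ∃ K : ℕ, ∀ x y, BRP.dist π (φ x) (φ y) ≤ K * BRP.dist π x y :=
    BRP.exists_lipschitz (Set.finite_range _) (BRP.closure_gens hπ) (BRP.closure_gens hπ) φ
  rw [BRP.hypBRPGromov_iff hπ]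
  tfae_have 4 → 1 := fun H => H.ftbrp hπ hδ
  tfae_have 1 → 4 := BRP.imageGPBounded_of_ftbrp hπ hinv hδ
  tfae_have 4 → 2 := fun H => H.hypBRPQuasi hπ
  tfae_have 2 → 3 := fun H => H.hypBRPGeo hπ
  tfae_have 3 → 5 := fun H => H.hypBRPGromovZero hπ hinv
  tfae_have 5 → 7 := fun H => H.hypBRPNbhd hπ hδ
  tfae_have 7 → 4 := fun H => H.imageGPBounded hπ hinv hδ hK
  tfae_have 7 → 6 := fun H => H.hypBRPHausdorff hπ hK
  tfae_have 6 → 7 := fun H => H.hypBRPNbhd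
  tfae_have 4 → 8 := fun H => H.coarseMedianPreserving hπ hδ
  tfae_have 8 → 7 := fun H => H.hypBRPNbhd hπ hinv hK
  tfae_finish
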